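/- Let $\mathcal A\subseteq B(\mathcal H)$ be a von Neumann algebra on a complex Hilbert space $\mathcal H$ (containing $\mathbb 1_{\mathcal H}$). A normal state on $\mathcal A$ is a functional $\varphi(x)=\operatorname{tr}(\rho x)$ with $\rho\ge 0$ of trace class and $\operatorname{tr}\rho=1$; its support $\operatorname{supp}\varphi$ is the smallest projection $p\in\mathcal A$ with $\varphi(x)=\varphi(pxp)$ for all $x\in\mathcal A$. The support $\operatorname{supp}a$ of a self-adjoint $a\in\mathcal A$ is the smallest projection $p\in\mathcal A$ with $a=pap$. A positive unital map $T:\mathcal A\to\mathcal A$ is normal if $\varphi\circ T$ is a normal state for every normal state $\varphi$ (equivalently, if $T$ preserves suprema of bounded increasing nets of positive elements). A Markov operator on $\mathcal A$ is a normal completely positive unital linear map $T:\mathcal A\to\mathcal A$. A potential for $T$ is an element $y\in\mathcal A_+$ of the form $y=\sum_{n=0}^\infty T^n(x)$ with $x\in\mathcal A_+$, the series converging in the strong operator topology. A projection $p\in\mathcal A$ is transient if $p\le\bigvee_i\operatorname{supp}y_i$ for some family $(y_i)$ of potentials, and positive recurrent if $p\le\bigvee_i\operatorname{supp}\varphi_i$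 for some family $(\varphi_i)$ of normal states with $\varphi_i\circ T=\varphi_i$. Let $p_{\mathrm{Tr}}$ and $p_{\mathrm R}$ be the suprema, among the projections of $\mathcal A$, of all transient and of all positive recurrent projections, respectively, and let $p_{\mathrm R_0}:=\mathbb 1-(p_{\mathrm{Tr}}+p_{\mathrm R})$ be the maximal null recurrent projection. An ergodic projection for $T$ is a linear map $P:\mathcal A\to\mathcal A$ in the pointwise weak*-closure of the convex hull of $\{T^n: n\ge 1\}$ with $TP=PT=P=P^2$; $T$ is weak* mean ergodic if it has a normal ergodic projection. Proposition. If $T:\mathcal A\to\mathcal A$ is a weak* mean ergodic Markov operator, then $p_{\mathrm R_0}=0$, i.e. $p_{\mathrm{Tr}}+p_{\mathrm R}=\mathbb 1$, so there is no null recurrent part. Moreover, the maximal transient projection $p_{\mathrm{Tr}}$ is itself a potential for $T$. -/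

import Mathlib

open Filter Topology
open scoped ComplexOrder

universe u

namespace QMarkov

noncomputable section

/-! ### Von Neumann algebras, their order and their projections -/

section Algebra

variable {H : Type u} [NormedAddCommGroup H] [InnerProductSpace ℂ H] [CompleteSpace H]

/-- The type of elements of a von Neumann algebra `A` of operators on `H`.  It carries the order
of `B(H)`: `a ≤ b` if and only if `b - a` is a positive operator. -/
abbrev Elem (A : VonNeumannAlgebra H) : Type u := A.toStarSubalgebra

theorem isClosed_carrier (A : VonNeumannAlgebra H) :
    IsClosed (A.toStarSubalgebra : Set (H →L[ℂ] H)) := by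
  have h : (A.toStarSubalgebra : Set (H →L[ℂ] H)) =
      ⋂ g ∈ Set.centralizer (A.toStarSubalgebra : Set (H →L[ℂ] H)), {z | g * z = z * g} := by
    have h1 := A.centralizer_centralizer'
    change Set.centralizer (Set.centralizer (A.toStarSubalgebra : Set (H →L[ℂ] H))) = _ at h1
    ext z
    refine (Set.ext_iff.1 h1 z).symm.trans ?_
    rw [Set.mem_centralizer_iff]
    simp
  rw [h]
  refine isClosed_biInter fun g _ => isClosed_eq ?_ ?_ <;> fun_prop

instance instIsClosedCarrier (A : VonNeumannAlgebra H) :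
    IsClosed (A.toStarSubalgebra : Set (H →L[ℂ] H)) := isClosed_carrier A

instance instCStarAlgebraElem (A : VonNeumannAlgebra H) : CStarAlgebra (Elem A) :=
  StarSubalgebra.cstarAlgebra A.toStarSubalgebra

/-- The positive elements of `A` are the elements `s* s` with `s ∈ A`. -/
instance instStarOrderedRingElem (A : VonNeumannAlgebra H) : StarOrderedRing (Elem A) := by
  refine StarOrderedRing.of_nonneg_iff' (fun {x y} hxy z => ?_) (fun x => ⟨fun hx => ?_, ?_⟩)
  · change (z : H →L[ℂ] H) + x ≤ z + y
    exact add_le_add_right (α := H →L[ℂ] H) hxy _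
  · have hsa : IsSelfAdjoint (x : H →L[ℂ] H) := IsSelfAdjoint.of_nonneg hx
    have hsa' : IsSelfAdjoint x := Subtype.ext hsa
    have hspec : SpectrumRestricts x ContinuousMap.realToNNReal := by
      have h1 : SpectrumRestricts (x : H →L[ℂ] H) ContinuousMap.realToNNReal :=
        SpectrumRestricts.nnreal_of_nonneg hx
      rw [SpectrumRestricts.nnreal_iff] at h1 ⊢
      intro r hr
      refine h1 r ?_
      have h2 : algebraMap ℝ ℂ r ∈ spectrum ℂ x := spectrum.algebraMap_mem_iff ℂ |>.2 hr
      rw [StarSubalgebra.spectrum_eq] at h2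
      exact spectrum.algebraMap_mem_iff ℂ |>.1 h2
    obtain ⟨s, hs, -, rfl⟩ :=
      CFC.exists_sqrt_of_isSelfAdjoint_of_quasispectrumRestricts hsa' hspec
    exact ⟨s, by rw [hs.star_eq]⟩
  · rintro ⟨s, rfl⟩
    change (0 : H →L[ℂ] H) ≤ star (s : H →L[ℂ] H) * s
    exact star_mul_self_nonneg _

/-- The orthogonal projections of `A`, ordered as operators. -/
abbrev Proj (A : VonNeumannAlgebra H) : Type u := {p : Elem A // IsStarProjection p}

/-- The closed subspace spanned by the ranges of a set of projections. -/
def supRange {A : VonNeumannAlgebra H} (S : Set (Proj A)) : Submodule ℂ H :=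
  (⨆ p ∈ S, (p.1 : H →L[ℂ] H).range).topologicalClosure

instance instProjSupRange {A : VonNeumannAlgebra H} (S : Set (Proj A)) :
    (supRange S).HasOrthogonalProjection := by
  have : CompleteSpace (supRange S) :=
    (Submodule.isClosed_topologicalClosure _).completeSpace_coe
  infer_instance

theorem isStarProjection_coe {A : VonNeumannAlgebra H} (p : Proj A) :
    IsStarProjection (p.1 : H →L[ℂ] H) :=
  ⟨congrArg Subtype.val p.2.isIdempotentElem, congrArg Subtype.val p.2.isSelfAdjoint⟩

theorem le_iff_range_le {A : VonNeumannAlgebra H} (p : Proj A) (U : Submodule ℂ H)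
    [U.HasOrthogonalProjection] :
    (p.1 : H →L[ℂ] H) ≤ U.starProjection ↔ (p.1 : H →L[ℂ] H).range ≤ U := by
  obtain ⟨h, h2⟩ := isStarProjection_iff_eq_starProjection_range.1 (isStarProjection_coe p)
  conv_lhs => rw [h2]
  exact Submodule.starProjection_le_starProjection_iff

theorem supRange_mem {A : VonNeumannAlgebra H} (S : Set (Proj A)) :
    (supRange S).starProjection ∈ A.toStarSubalgebra := by
  refine (VonNeumannAlgebra.IsStarProjection.mem_iff
    (isStarProjection_starProjection (U := supRange S)) A).2 fun y hy => ?_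
  rw [Submodule.range_starProjection, Module.End.mem_invtSubmodule]
  have h1 : (⨆ p ∈ S, (p.1 : H →L[ℂ] H).range) ≤
      (⨆ p ∈ S, (p.1 : H →L[ℂ] H).range).comap (y : H →ₗ[ℂ] H) := by
    refine iSup₂_le fun p hp => ?_
    have h2 := (VonNeumannAlgebra.IsStarProjection.mem_iff (isStarProjection_coe p) A).1
      p.1.2 y hy
    exact ((Module.End.mem_invtSubmodule _).1 h2).trans
      (Submodule.comap_mono (le_iSup₂_of_le p hp le_rfl))
  intro ξ hξ
  exact map_mem_closure y.continuous hξ fun η hη => h1 hη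

/-- The supremum of a set of projections of `A`: the projection onto the closed subspace spanned
by their ranges. -/
instance instSupSetProj (A : VonNeumannAlgebra H) : SupSet (Proj A) where
  sSup S := ⟨⟨(supRange S).starProjection, supRange_mem S⟩, by
    have h := isStarProjection_starProjection (U := supRange S)
    exact ⟨Subtype.ext h.isIdempotentElem, Subtype.ext h.isSelfAdjoint⟩⟩

theorem isLUB_sSup_proj (A : VonNeumannAlgebra H) (S : Set (Proj A)) : IsLUB S (sSup S) := by
  constructor
  · intro p hp
    change (p.1 : H →L[ℂ] H) ≤ (supRange S).starProjection
    rw [le_iff_range_le]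
    exact (le_iSup₂_of_le (f := fun (p : Proj A) (_ : p ∈ S) => (p.1 : H →L[ℂ] H).range)
      p hp le_rfl).trans (Submodule.le_topologicalClosure _)
  · intro q hq
    change (supRange S).starProjection ≤ (q.1 : H →L[ℂ] H)
    obtain ⟨h, h2⟩ := isStarProjection_iff_eq_starProjection_range.1 (isStarProjection_coe q)
    rw [h2, Submodule.starProjection_le_starProjection_iff]
    refine Submodule.topologicalClosure_minimal _ (iSup₂_le fun p hp => ?_) ?_
    · rw [← le_iff_range_le, ← h2]
      exact hq hp
    · exact ContinuousLinearMap.IsIdempotentElem.isClosed_range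
        (isStarProjection_coe q).isIdempotentElem

/-- The projections of `A` form a complete lattice. -/
instance instCompleteLatticeProj (A : VonNeumannAlgebra H) : CompleteLattice (Proj A) :=
  completeLatticeOfSup (Proj A) (isLUB_sSup_proj A)

/-- The support of a self-adjoint element `a`: the smallest projection `p` with `a = p a p`. -/
def supp {A : VonNeumannAlgebra H} (a : Elem A) : Proj A :=
  sInf {p : Proj A | a = p.1 * a * p.1}

/-! ### Normal states -/

/-- `t` is the trace of `a`: in every orthonormal basis the diagonal of `a` sums to `t`. -/
def HasTrace (a : H →L[ℂ] H) (t : ℂ) : Prop :=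
  ∀ (ι : Type u) (b : HilbertBasis ι ℂ H), HasSum (fun i => inner ℂ (b i) (a (b i))) t

/-- A density operator: a positive trace class operator of trace one. -/
def IsDensity (ρ : H →L[ℂ] H) : Prop := 0 ≤ ρ ∧ HasTrace ρ 1

/-- A normal state of `A`: a linear functional of the form `x ↦ tr (ρ x)` with a density
operator `ρ` on `H`. -/
def IsNormalState {A : VonNeumannAlgebra H} (φ : Elem A →ₗ[ℂ] ℂ) : Prop :=
  ∃ ρ : H →L[ℂ] H, IsDensity ρ ∧ ∀ x : Elem A, HasTrace (ρ * (x : H →L[ℂ] H)) (φ x)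

/-- The support of a normal state: the smallest projection `p` with `φ (x) = φ (p x p)` for all
`x`. -/
def stateSupp {A : VonNeumannAlgebra H} (φ : Elem A →ₗ[ℂ] ℂ) : Proj A :=
  sInf {p : Proj A | ∀ x : Elem A, φ x = φ (p.1 * x * p.1)}

/-- The weak* topology of `A`: the coarsest topology for which every normal state (equivalently,
every element of the predual, which is the linear span of the normal states) is continuous. -/
abbrev weakStarTopology (A : VonNeumannAlgebra H) : TopologicalSpace (Elem A) :=
  ⨅ (φ : Elem A →ₗ[ℂ] ℂ) (_ : IsNormalState φ), TopologicalSpace.induced φ inferInstance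

/-! ### Markov operators -/

/-- Normality of a positive unital map: composing a normal state with it gives a normal state. -/
def IsNormalMap {A : VonNeumannAlgebra H} (T : Elem A →ₗ[ℂ] Elem A) : Prop :=
  ∀ φ : Elem A →ₗ[ℂ] ℂ, IsNormalState φ → IsNormalState (φ ∘ₗ T)

/-- A (quantum) Markov operator: a normal completely positive unital map. -/
structure IsMarkov {A : VonNeumannAlgebra H} (T : Elem A →ₗ[ℂ] Elem A) : Prop where
  completelyPositive : ∃ Φ : CompletelyPositiveMap (Elem A) (Elem A), Φ.toLinearMap = T
  unital : T 1 = 1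
  normal : IsNormalMap T

/-- A stationary normal state for `T`. -/
def IsStationary {A : VonNeumannAlgebra H} (T : Elem A →ₗ[ℂ] Elem A) (φ : Elem A →ₗ[ℂ] ℂ) :
    Prop :=
  IsNormalState φ ∧ φ ∘ₗ T = φ

/-! ### Potentials, transience and recurrence -/

/-- `y = ∑ₙ Tⁿ x`, the series converging in the strong operator topology. -/
def HasOrbitSum {A : VonNeumannAlgebra H} (T : Elem A →ₗ[ℂ] Elem A) (x y : Elem A) : Prop :=
  ∀ ξ : H, Tendsto
    (fun N : ℕ => ∑ n ∈ Finset.range N, (((T ^ n) x : Elem A) : H →L[ℂ] H) ξ)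
    atTop (𝓝 ((y : H →L[ℂ] H) ξ))

/-- A potential for `T`: a positive `y = ∑ₙ Tⁿ x` with a positive charge `x`. -/
def IsPotential {A : VonNeumannAlgebra H} (T : Elem A →ₗ[ℂ] Elem A) (y : Elem A) : Prop :=
  0 ≤ y ∧ ∃ x : Elem A, 0 ≤ x ∧ HasOrbitSum T x y

/-- A transient projection: one that is dominated by the supremum of the supports of a family of
potentials. -/
def IsTransient {A : VonNeumannAlgebra H} (T : Elem A →ₗ[ℂ] Elem A) (p : Proj A) : Prop :=
  ∃ Y : Set (Elem A), (∀ y ∈ Y, IsPotential T y) ∧ p ≤ ⨆ y ∈ Y, supp y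

/-- The maximal transient projection `p_Tr`. -/
def maxTransient {A : VonNeumannAlgebra H} (T : Elem A →ₗ[ℂ] Elem A) : Proj A :=
  sSup {p | IsTransient T p}

/-- A positive recurrent projection: one that is dominated by the supremum of the supports of a
family of stationary normal states. -/
def IsPositiveRecurrent {A : VonNeumannAlgebra H} (T : Elem A →ₗ[ℂ] Elem A) (p : Proj A) :
    Prop :=
  ∃ F : Set (Elem A →ₗ[ℂ] ℂ), (∀ φ ∈ F, IsStationary T φ) ∧ p ≤ ⨆ φ ∈ F, stateSupp φ

/-- The maximal positive recurrent projection `p_R`. -/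
def maxPositiveRecurrent {A : VonNeumannAlgebra H} (T : Elem A →ₗ[ℂ] Elem A) : Proj A :=
  sSup {p | IsPositiveRecurrent T p}

/-- The maximal null recurrent projection `1 - (p_Tr + p_R)`. -/
def maxNullRecurrent {A : VonNeumannAlgebra H} (T : Elem A →ₗ[ℂ] Elem A) : Elem A :=
  1 - ((maxTransient T).1 + (maxPositiveRecurrent T).1)

/-! ### Weak* mean ergodicity -/

/-- An ergodic projection for `T`: a map `P` in the pointwise weak* closure of the convex hull of
`{Tⁿ | n ≥ 1}` with `T P = P T = P = P²`. -/
structure IsErgodicProjection {A : VonNeumannAlgebra H} (T P : Elem A →ₗ[ℂ] Elem A) : Prop where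
  mem_closure : (P : Elem A → Elem A) ∈
    @closure (Elem A → Elem A) (@Pi.topologicalSpace _ _ fun _ => weakStarTopology A)
      ((fun Φ : Elem A →ₗ[ℂ] Elem A => (Φ : Elem A → Elem A)) ''
        convexHull ℝ {Φ | ∃ n : ℕ, 1 ≤ n ∧ Φ = T ^ n})
  comp_left : T ∘ₗ P = P
  comp_right : P ∘ₗ T = P
  idem : P ∘ₗ P = P

/-- `T` is weak* mean ergodic: it has a normal ergodic projection. -/
def IsWeakStarMeanErgodic {A : VonNeumannAlgebra H} (T : Elem A →ₗ[ℂ] Elem A) : Prop :=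
  ∃ P : Elem A →ₗ[ℂ] Elem A, IsErgodicProjection T P ∧ IsNormalMap P

end Algebra

end

end QMarkov

namespace QMarkov

/-! ### Hilbert–Schmidt operators and cyclicity of the trace -/

section Trace

/-! Let q = 1 - p_R. The point is that q is a potential. Stationary states vanish on q, hence on T
q, so T q lives under q and T q ≤ 1 compresses to T q ≤ q (`map_compl_maxPositiveRecurrent_le`).
Thus Tⁿ q decreases strongly to some z, and normality gives T z = z. The normal ergodic projection P
fixes z, while P q = 0 because φ ∘ P is stationary for every normal state φ. From 0 ≤ z ≤ q follows
z = P z ≤ P q = 0, so ∑ Tⁿ (q - T q) telescopes to q, and q is transient.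

Conversely, a stationary φ takes the value N φ(x) on the N-th partial sum of a potential with charge
x. Convergence forces φ(x) = 0, so φ kills every potential, whose support therefore lies under q
(`maxTransient_le_compl`). Hence p_Tr = q.

The analytic base is `IsNormalState.exists_vectors`: a normal state is ∑ ⟨η i, · η i⟩ with ∑ ‖η i‖²
finite, which turns supports and continuity into statements about the vectors η i. -/

theorem _root_.HasSum.congr_fun' {ι α : Type*} [AddCommMonoid α] [TopologicalSpace α] {f g : ι → α}
    {a : α} (h : HasSum f a) (hfg : ∀ i, g i = f i) : HasSum g a :=
  (funext hfg : g = f) ▸ h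


variable {H : Type u} [NormedAddCommGroup H] [InnerProductSpace ℂ H] [CompleteSpace H]

local notation "⟪" x ", " y "⟫" => inner ℂ x y

/-- Parseval's identity. -/
theorem hasSum_norm_inner_sq {H : Type*} [NormedAddCommGroup H] [InnerProductSpace ℂ H]
    {ι : Type*} (b : HilbertBasis ι ℂ H) (v : H) :
    HasSum (fun i => ‖⟪b i, v⟫‖ ^ 2) (‖v‖ ^ 2) := by
  have h := (b.hasSum_inner_mul_inner v v).mapL Complex.reCLM
  convert h using 1
  · ext i
    rw [← inner_conj_symm v (b i), ← Complex.normSq_eq_conj_mul_self]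
    simp only [Complex.normSq_eq_norm_sq, Complex.reCLM_apply, Complex.ofReal_re]
  · simp [inner_self_eq_norm_sq_to_K]
    norm_cast

theorem summable_norm_inner_sq {H : Type*} [NormedAddCommGroup H] [InnerProductSpace ℂ H]
    {ι : Type*} (b : HilbertBasis ι ℂ H) {v : ι → H}
    (hv : Summable fun i => ‖v i‖ ^ 2) :
    Summable fun p : ι × ι => ‖⟪b p.1, v p.2⟫‖ ^ 2 := by
  rw [← (Equiv.prodComm ι ι).summable_iff]
  refine (summable_prod_of_nonneg fun p => sq_nonneg _).2 ⟨fun i => ?_, ?_⟩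
  · exact (hasSum_norm_inner_sq b (v i)).summable
  · convert hv using 2 with i
    exact (hasSum_norm_inner_sq b (v i)).tsum_eq

theorem summable_norm_apply_sq {H : Type*} [NormedAddCommGroup H] [InnerProductSpace ℂ H]
    {ι : Type*} {v : ι → H} (hv : Summable fun i => ‖v i‖ ^ 2) (x : H →L[ℂ] H) :
    Summable fun i => ‖x (v i)‖ ^ 2 := by
  refine Summable.of_nonneg_of_le (fun i => by positivity) (fun i => ?_) (hv.mul_left (‖x‖ ^ 2))
  rw [← mul_pow]
  gcongr
  exact x.le_opNorm _

/-- Cyclicity of the trace, for a product of two copies of a Hilbert–Schmidt operator. -/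
theorem exists_hasSum_inner_cyclic {ι : Type*} (b : HilbertBasis ι ℂ H) {s : H →L[ℂ] H}
    (hs : IsSelfAdjoint s) (hsum : Summable fun i => ‖s (b i)‖ ^ 2) (x : H →L[ℂ] H) :
    ∃ t : ℂ, HasSum (fun i => ⟪b i, s (s (x (b i)))⟫) t ∧
      HasSum (fun i => ⟪s (b i), x (s (b i))⟫) t := by
  have hsym : ∀ v w : H, ⟪s v, w⟫ = ⟪v, s w⟫ := hs.isSymmetric
  -- Summing this double series over the second index first gives the trace of s s x, over the first
  -- index first gives the other sum; absolute summability allows the exchange.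
  set f : ι × ι → ℂ := fun p => ⟪b p.1, s (b p.2)⟫ * ⟪b p.2, s (x (b p.1))⟫ with hf
  have hsw : ∀ i j, ⟪b j, s (x (b i))⟫ = ⟪x.adjoint (s (b j)), b i⟫ := fun i j => by
    rw [ContinuousLinearMap.adjoint_inner_left, hsym]
  have h1 := summable_norm_inner_sq b hsum
  have h2 := summable_norm_inner_sq b (summable_norm_apply_sq hsum x.adjoint)
  have hsf : Summable f := by
    refine Summable.of_norm_bounded (h1.add h2) fun p => ?_
    rw [hf, norm_mul, hsw, norm_inner_symm (x.adjoint _)]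
    nlinarith [sq_nonneg (‖⟪b p.1, s (b p.2)⟫‖ - ‖⟪b p.1, x.adjoint (s (b p.2))⟫‖),
      sq_nonneg (‖⟪b p.1, s (b p.2)⟫‖), sq_nonneg (‖⟪b p.1, x.adjoint (s (b p.2))⟫‖)]
  refine ⟨∑' p, f p, hsf.hasSum.prod_fiberwise fun i => ?_, ?_⟩
  · have h := b.hasSum_inner_mul_inner (s (b i)) (s (x (b i)))
    rw [hsym] at h
    simpa only [hsym] using h
  · have h3 : HasSum (f ∘ Equiv.prodComm ι ι) (∑' p, f p) :=
      (Equiv.prodComm ι ι).hasSum_iff.2 hsf.hasSum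
    refine h3.prod_fiberwise fun j => ?_
    have h := b.hasSum_inner_mul_inner (x.adjoint (s (b j))) (s (b j))
    rw [ContinuousLinearMap.adjoint_inner_left] at h
    refine h.congr_fun' fun i => ?_
    simp only [hf, Function.comp_apply, Equiv.prodComm_apply, Prod.fst_swap, Prod.snd_swap, hsw]
    exact mul_comm _ _

end Trace

/-! ### Normal states as sums of vector functionals; positivity and continuity -/

section NormalStates

variable {H : Type u} [NormedAddCommGroup H] [InnerProductSpace ℂ H] [CompleteSpace H]
  {A : VonNeumannAlgebra H}

local notation "⟪" x ", " y "⟫" => inner ℂ x y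

theorem HasTrace.unique {a : H →L[ℂ] H} {s t : ℂ} (hs : HasTrace a s) (ht : HasTrace a t) :
    s = t := by
  obtain ⟨w, b, -⟩ := exists_hilbertBasis ℂ H
  exact (hs w b).unique (ht w b)

theorem IsNormalState.map_one {φ : Elem A →ₗ[ℂ] ℂ} (hφ : IsNormalState φ) : φ 1 = 1 := by
  obtain ⟨ρ, hρ, h⟩ := hφ
  have h1 := h 1
  rw [show ((1 : Elem A) : H →L[ℂ] H) = 1 from rfl, mul_one] at h1
  exact h1.unique hρ.2

/-- A normal state is a sum of vector functionals. -/
theorem IsNormalState.exists_vectors {φ : Elem A →ₗ[ℂ] ℂ} (hφ : IsNormalState φ) :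
    ∃ (ι : Type u) (η : ι → H), Summable (fun i => ‖η i‖ ^ 2) ∧
      ∀ x : Elem A, HasSum (fun i => ⟪η i, (x : H →L[ℂ] H) (η i)⟫) (φ x) := by
  obtain ⟨ρ, ⟨hρ0, hρ1⟩, h⟩ := hφ
  obtain ⟨w, b, -⟩ := exists_hilbertBasis ℂ H
  -- The vectors are η i = s (b i): their squared norms sum to tr ρ, and cyclicity moves one factor
  -- s across x.
  set s := CFC.sqrt ρ
  have hss : s * s = ρ := CFC.sqrt_mul_sqrt_self ρ hρ0
  have hs : IsSelfAdjoint s := .of_nonneg (CFC.sqrt_nonneg ρ)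
  have hsum : Summable fun i => ‖s (b i)‖ ^ 2 := by
    have h1 := ((hρ1 w b).mapL Complex.reCLM).summable
    convert h1 using 2 with i
    have h2 : ⟪b i, ρ (b i)⟫ = ⟪s (b i), s (b i)⟫ := by
      rw [← hss]
      exact (hs.isSymmetric _ _).symm
    rw [h2, inner_self_eq_norm_sq_to_K]
    simp
    norm_cast
  refine ⟨w, fun i => s (b i), hsum, fun x => ?_⟩
  obtain ⟨t, ht1, ht2⟩ := exists_hasSum_inner_cyclic b hs hsum x
  have h3 := h x w b
  rw [← hss] at h3
  rwa [h3.unique ht1]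

/-- The functional `x ↦ ⟨ξ, x ξ⟩`. -/
noncomputable def vectorFunctional (A : VonNeumannAlgebra H) (ξ : H) : Elem A →ₗ[ℂ] ℂ where
  toFun x := ⟪ξ, (x : H →L[ℂ] H) ξ⟫
  map_add' x y := by simp
  map_smul' c x := by simp

theorem isNormalState_vectorFunctional {ξ : H} (hξ : ‖ξ‖ = 1) :
    IsNormalState (vectorFunctional A ξ) := by
  have key : ∀ x : H →L[ℂ] H, HasTrace (InnerProductSpace.rankOne ℂ ξ ξ * x) ⟪ξ, x ξ⟫ := by
    intro x ι b
    have h := b.hasSum_inner_mul_inner (x.adjoint ξ) ξ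
    rw [ContinuousLinearMap.adjoint_inner_left] at h
    refine h.congr_fun' fun i => ?_
    simp [ContinuousLinearMap.adjoint_inner_left]
  refine ⟨InnerProductSpace.rankOne ℂ ξ ξ, ⟨?_, ?_⟩, fun x => key x⟩
  · rw [ContinuousLinearMap.nonneg_iff_isPositive]
    exact InnerProductSpace.isPositive_rankOne_self ξ
  · have h := key 1
    rw [mul_one] at h
    convert h using 1
    simp [inner_self_eq_norm_sq_to_K, hξ]

theorem nonneg_iff_inner {a : Elem A} :
    0 ≤ a ↔ ∀ ξ : H, 0 ≤ ⟪ξ, (a : H →L[ℂ] H) ξ⟫ := by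
  change (0 : H →L[ℂ] H) ≤ a ↔ _
  rw [ContinuousLinearMap.nonneg_iff_isPositive]
  refine ⟨fun h => h.inner_nonneg_right, fun h => ?_⟩
  refine (ContinuousLinearMap.isPositive_iff_complex _).2 fun x => ?_
  have h1 := Complex.nonneg_iff.1 (h x)
  have h2 : ⟪(a : H →L[ℂ] H) x, x⟫ = ⟪x, (a : H →L[ℂ] H) x⟫ := by
    rw [← inner_conj_symm]
    exact Complex.conj_eq_iff_im.2 h1.2.symm
  rw [h2]
  exact ⟨RCLike.ext (by simp) (by simpa using h1.2), h1.1⟩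

/-- Unit vector states already test positivity, after normalising ξ. -/
theorem nonneg_of_normalState {a : Elem A}
    (h : ∀ φ : Elem A →ₗ[ℂ] ℂ, IsNormalState φ → 0 ≤ φ a) : 0 ≤ a := by
  refine nonneg_iff_inner.2 fun ξ => ?_
  by_cases hξ : ξ = 0
  · simp [hξ]
  have h1 := h _ (isNormalState_vectorFunctional (A := A)
    (ξ := ((‖ξ‖ : ℂ)⁻¹) • ξ) (norm_smul_inv_norm hξ))
  have hpos : (0 : ℂ) < ‖ξ‖ := by exact_mod_cast norm_pos_iff.2 hξ
  have h2 : ⟪ξ, (a : H →L[ℂ] H) ξ⟫ =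
      ((‖ξ‖ : ℂ) * ‖ξ‖) * vectorFunctional A ((‖ξ‖ : ℂ)⁻¹ • ξ) a := by
    simp only [vectorFunctional, LinearMap.coe_mk, AddHom.coe_mk, map_smul, inner_smul_left,
      inner_smul_right, map_inv₀, Complex.conj_ofReal]
    field_simp
  rw [h2]
  positivity

theorem IsNormalState.map_nonneg {φ : Elem A →ₗ[ℂ] ℂ} (hφ : IsNormalState φ) {a : Elem A}
    (ha : 0 ≤ a) : 0 ≤ φ a := by
  obtain ⟨ι, η, -, h⟩ := hφ.exists_vectors
  exact (h a).nonneg fun i => nonneg_iff_inner.1 ha _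

/-- Normal states separate the points of `A`. -/
theorem eq_of_normalState {a b : Elem A}
    (h : ∀ φ : Elem A →ₗ[ℂ] ℂ, IsNormalState φ → φ a = φ b) : a = b := by
  refine le_antisymm ?_ ?_ <;> rw [← sub_nonneg] <;>
    exact nonneg_of_normalState fun φ hφ => by simp [h φ hφ]

/-- States pull back to states, so positivity is part of normality. This serves both T and the
ergodic projection. -/
theorem IsNormalMap.map_nonneg {T : Elem A →ₗ[ℂ] Elem A} (hT : IsNormalMap T) {a : Elem A}
    (ha : 0 ≤ a) : 0 ≤ T a :=
  nonneg_of_normalState fun φ hφ => (hT φ hφ).map_nonneg ha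

theorem IsNormalMap.map_one {T : Elem A →ₗ[ℂ] Elem A} (hT : IsNormalMap T) : T 1 = 1 :=
  eq_of_normalState fun φ hφ => (hT φ hφ).map_one.trans hφ.map_one.symm

theorem IsNormalMap.mono {T : Elem A →ₗ[ℂ] Elem A} (hT : IsNormalMap T) : Monotone T :=
  fun a b hab => by
    rw [← sub_nonneg, ← map_sub]
    exact hT.map_nonneg (sub_nonneg.2 hab)

/-- Normal states are continuous along bounded strongly convergent sequences. -/
theorem IsNormalState.tendsto {φ : Elem A →ₗ[ℂ] ℂ} (hφ : IsNormalState φ) {a : ℕ → Elem A}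
    {z : Elem A} {C : ℝ} (hC : ∀ n, ‖a n‖ ≤ C)
    (h : ∀ ξ : H, Tendsto (fun n => (a n : H →L[ℂ] H) ξ) atTop (𝓝 ((z : H →L[ℂ] H) ξ))) :
    Tendsto (fun n => φ (a n)) atTop (𝓝 (φ z)) := by
  obtain ⟨ι, η, hη, hsum⟩ := hφ.exists_vectors
  simp only [← (hsum _).tsum_eq]
  refine tendsto_tsum_of_dominated_convergence (hη.mul_left C)
    (fun i => tendsto_const_nhds.inner (h (η i))) (Eventually.of_forall fun n i => ?_)
  calc ‖⟪η i, (a n : H →L[ℂ] H) (η i)⟫‖ ≤ ‖η i‖ * ‖(a n : H →L[ℂ] H) (η i)‖ :=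
        norm_inner_le_norm _ _
    _ ≤ ‖η i‖ * (C * ‖η i‖) := by
        gcongr
        exact ((a n : H →L[ℂ] H).le_opNorm _).trans (by gcongr; exact hC n)
    _ = C * ‖η i‖ ^ 2 := by ring

end NormalStates

/-! ### Projections of the algebra and monotone limits -/

section Projections

variable {H : Type u} [NormedAddCommGroup H] [InnerProductSpace ℂ H] [CompleteSpace H]
  {A : VonNeumannAlgebra H}

local notation "⟪" x ", " y "⟫" => inner ℂ x y

theorem Proj.le_iff_fixed {p q : Proj A} :
    p ≤ q ↔ ∀ ξ : H, (p.1 : H →L[ℂ] H) ξ = ξ → (q.1 : H →L[ℂ] H) ξ = ξ := by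
  rw [← Subtype.coe_le_coe, p.2.le_iff_mul_eq_right q.2]
  constructor
  · intro h ξ hξ
    have h1 := congrArg (fun a : Elem A => (a : H →L[ℂ] H) ξ) h
    change (q.1 : H →L[ℂ] H) ((p.1 : H →L[ℂ] H) ξ) = (p.1 : H →L[ℂ] H) ξ at h1
    rwa [hξ] at h1
  · refine fun h => Subtype.ext (ContinuousLinearMap.ext fun ξ => h _ ?_)
    exact congrArg (fun a : H →L[ℂ] H => a ξ) (isStarProjection_coe p).isIdempotentElem

/-- The complementary projection `1 - p`. -/
noncomputable def Proj.compl (p : Proj A) : Proj A := ⟨1 - p.1, p.2.one_sub⟩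

theorem Proj.compl_apply (p : Proj A) (ξ : H) :
    ((p.compl).1 : H →L[ℂ] H) ξ = ξ - (p.1 : H →L[ℂ] H) ξ := rfl

theorem Proj.le_compl_comm {p q : Proj A} : p ≤ q.compl ↔ q ≤ p.compl := by
  rw [← Subtype.coe_le_coe, ← Subtype.coe_le_coe]
  exact le_sub_comm

theorem Proj.compl_compl (p : Proj A) : p.compl.compl = p :=
  Subtype.ext (sub_sub_cancel _ _)

theorem Proj.nonneg (p : Proj A) : 0 ≤ p.1 := p.2.nonneg

theorem Proj.le_one (p : Proj A) : p.1 ≤ 1 := sub_nonneg.1 p.2.one_sub.nonneg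

/-- The infimum of a set of projections fixes every vector fixed by all of them. -/
theorem Proj.sInf_apply_eq {S : Set (Proj A)} {ξ : H}
    (h : ∀ p ∈ S, (p.1 : H →L[ℂ] H) ξ = ξ) : ((sInf S).1 : H →L[ℂ] H) ξ = ξ := by
  -- De Morgan: only suprema are concrete (closed spans), so the infimum is reached through the
  -- complements, whose ranges are orthogonal to ξ.
  set q : Proj A := sSup (Proj.compl '' S)
  have hq : q.compl ≤ sInf S := le_sInf fun p hp => by
    rw [← p.compl_compl, Proj.le_compl_comm, Proj.compl_compl]
    exact le_sSup ⟨p, hp, rfl⟩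
  refine Proj.le_iff_fixed.1 hq ξ ?_
  have h1 : supRange (Proj.compl '' S) ≤ (ℂ ∙ ξ)ᗮ := by
    refine Submodule.topologicalClosure_minimal _ (iSup₂_le ?_) (Submodule.isClosed_orthogonal _)
    rintro _ ⟨p, hp, rfl⟩ _ ⟨v, rfl⟩
    refine Submodule.mem_orthogonal_singleton_iff_inner_right.2 ?_
    have h2 : ∀ v w : H, ⟪(p.compl.1 : H →L[ℂ] H) v, w⟫ = ⟪v, (p.compl.1 : H →L[ℂ] H) w⟫ :=
      (isStarProjection_coe p.compl).isSelfAdjoint.isSymmetric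
    change ⟪ξ, (p.compl.1 : H →L[ℂ] H) v⟫ = 0
    rw [← h2, Proj.compl_apply, h p hp, sub_self, inner_zero_left]
  have h3 : (q.1 : H →L[ℂ] H) ξ = 0 := by
    change (supRange (Proj.compl '' S)).starProjection ξ = 0
    rw [Submodule.starProjection_apply_eq_zero_iff]
    exact fun v hv => Submodule.mem_orthogonal_singleton_iff_inner_left.1 (h1 hv)
  rw [Proj.compl_apply, h3, sub_zero]

/-- The projection onto the kernel of an element of `A` belongs to `A`. -/
theorem exists_kernel_proj (a : Elem A) :
    ∃ k : Proj A, ∀ ξ : H, (k.1 : H →L[ℂ] H) ξ = ξ ↔ (a : H →L[ℂ] H) ξ = 0 := by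
  set U : Submodule ℂ H := (a : H →L[ℂ] H).ker
  have hU : CompleteSpace U := (ContinuousLinearMap.isClosed_ker (a : H →L[ℂ] H)).completeSpace_coe
  have hp := isStarProjection_starProjection (U := U)
  have hmem : U.starProjection ∈ A.toStarSubalgebra := by
    -- The kernel of a is invariant under the commutant.
    refine (VonNeumannAlgebra.IsStarProjection.mem_iff hp A).2 fun y hy => ?_
    rw [Submodule.range_starProjection, Module.End.mem_invtSubmodule]
    intro ξ hξ
    have hc := congrArg (fun b : H →L[ℂ] H => b ξ)
      (VonNeumannAlgebra.mem_commutant_iff.1 hy (a : H →L[ℂ] H) a.2)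
    change (a : H →L[ℂ] H) (y ξ) = y ((a : H →L[ℂ] H) ξ) at hc
    change (a : H →L[ℂ] H) (y ξ) = 0
    rw [hc, show (a : H →L[ℂ] H) ξ = 0 from hξ, map_zero]
  refine ⟨⟨⟨U.starProjection, hmem⟩,
    Subtype.ext hp.isIdempotentElem, Subtype.ext hp.isSelfAdjoint⟩, fun ξ => ?_⟩
  exact Submodule.starProjection_eq_self_iff

/-- For positive `a`,
`‖a ξ‖² ≤ ‖a‖ ⟨ξ, a ξ⟩`. -/
theorem norm_apply_sq_le {a : Elem A} (ha : 0 ≤ a) (ξ : H) :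
    ‖(a : H →L[ℂ] H) ξ‖ ^ 2 ≤ ‖a‖ * (⟪ξ, (a : H →L[ℂ] H) ξ⟫).re := by
  set b : H →L[ℂ] H := (a : H →L[ℂ] H)
  have hb : 0 ≤ b := ha
  set s := CFC.sqrt b
  have hss : s * s = b := CFC.sqrt_mul_sqrt_self b hb
  have hs : IsSelfAdjoint s := .of_nonneg (CFC.sqrt_nonneg b)
  have h1 : b ξ = s (s ξ) := by rw [← hss]; rfl
  have h2 : ⟪ξ, b ξ⟫ = ((‖s ξ‖ ^ 2 : ℝ) : ℂ) := by
    rw [h1]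
    refine (hs.isSymmetric ξ (s ξ)).symm.trans ?_
    simp
  have h3 : ‖a‖ = ‖s‖ ^ 2 := by
    change ‖b‖ = _
    rw [← hss, sq, hs.norm_mul_self, sq]
  rw [h2, Complex.ofReal_re, h3, h1, ← mul_pow]
  gcongr
  exact s.le_opNorm _

/-- A bounded decreasing sequence of positive elements of `A` converges strongly in `A`. -/
theorem exists_tendsto_of_antitone {a : ℕ → Elem A} (ha : Antitone a) (h0 : ∀ n, 0 ≤ a n) :
    ∃ z : Elem A, ∀ ξ : H,
      Tendsto (fun n => (a n : H →L[ℂ] H) ξ) atTop (𝓝 ((z : H →L[ℂ] H) ξ)) := by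
  have hcauchy : ∀ ξ : H, CauchySeq fun n => (a n : H →L[ℂ] H) ξ := by
    intro ξ
    set r : ℕ → ℝ := fun n => (⟪ξ, (a n : H →L[ℂ] H) ξ⟫).re with hr
    -- `norm_apply_sq_le` for a m - a n makes strong Cauchyness follow from convergence of the
    -- quadratic forms.
    have hsub : ∀ m n, m ≤ n → ‖(a m : H →L[ℂ] H) ξ - (a n : H →L[ℂ] H) ξ‖ ^ 2 ≤
        ‖a 0‖ * (r m - r n) := by
      intro m n hmn
      have hd : 0 ≤ a m - a n := sub_nonneg.2 (ha hmn)
      have hle : ‖a m - a n‖ ≤ ‖a 0‖ := CStarAlgebra.norm_le_norm_of_nonneg_of_le hd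
        ((sub_le_self _ (h0 n)).trans (ha (Nat.zero_le m)))
      have h1 := norm_apply_sq_le hd ξ
      have h2 : ⟪ξ, ((a m - a n : Elem A) : H →L[ℂ] H) ξ⟫ =
          ⟪ξ, (a m : H →L[ℂ] H) ξ⟫ - ⟪ξ, (a n : H →L[ℂ] H) ξ⟫ := by
        rw [← inner_sub_right]; rfl
      have h3 : 0 ≤ r m - r n := by
        have := (Complex.nonneg_iff.1 (nonneg_iff_inner.1 hd ξ)).1
        rwa [h2, Complex.sub_re] at this
      rw [h2, Complex.sub_re] at h1
      exact h1.trans (mul_le_mul_of_nonneg_right hle h3)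
    have hanti : Antitone r := fun m n hmn => by
      have := (Complex.nonneg_iff.1 (nonneg_iff_inner.1 (sub_nonneg.2 (ha hmn)) ξ)).1
      change 0 ≤ (⟪ξ, (a m : H →L[ℂ] H) ξ - (a n : H →L[ℂ] H) ξ⟫).re at this
      rwa [inner_sub_right, Complex.sub_re, sub_nonneg] at this
    have hbdd : BddBelow (Set.range r) :=
      ⟨0, by rintro _ ⟨n, rfl⟩; exact (Complex.nonneg_iff.1 (nonneg_iff_inner.1 (h0 n) ξ)).1⟩
    have hlim := tendsto_atTop_ciInf hanti hbdd
    set l := ⨅ n, r n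
    refine cauchySeq_of_le_tendsto_0 (fun N => 2 * √(‖a 0‖ * (r N - l))) (fun n m N hn hm => ?_) ?_
    · have key : ∀ n, N ≤ n → ‖(a N : H →L[ℂ] H) ξ - (a n : H →L[ℂ] H) ξ‖ ≤
          √(‖a 0‖ * (r N - l)) := fun n hn => by
        refine Real.le_sqrt_of_sq_le ((hsub N n hn).trans ?_)
        gcongr
        exact ciInf_le hbdd n
      have h1 := dist_triangle_left ((a n : H →L[ℂ] H) ξ) ((a m : H →L[ℂ] H) ξ)
        ((a N : H →L[ℂ] H) ξ)
      rw [dist_eq_norm ((a N : H →L[ℂ] H) ξ), dist_eq_norm ((a N : H →L[ℂ] H) ξ)] at h1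
      linarith [key n hn, key m hm]
    · have h1 : Tendsto (fun N => 2 * √(‖a 0‖ * (r N - l))) atTop
          (𝓝 (2 * √(‖a 0‖ * (l - l)))) :=
        ((hlim.sub_const l).const_mul _).sqrt.const_mul 2
      simpa using h1
  choose f hf using fun ξ => cauchySeq_tendsto_of_complete (hcauchy ξ)
  set z := continuousLinearMapOfTendsto (fun n => (a n : H →L[ℂ] H)) (tendsto_pi_nhds.2 hf)
  refine ⟨⟨z, ?_⟩, hf⟩
  change z ∈ A
  -- Bicommutant: the strong limit still commutes with everything in the commutant.
  rw [← A.commutant_commutant, VonNeumannAlgebra.mem_commutant_iff]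
  intro g hg
  refine ContinuousLinearMap.ext fun ξ => ?_
  refine tendsto_nhds_unique (f := fun n => g ((a n : H →L[ℂ] H) ξ))
    ((g.continuous.tendsto _).comp (hf ξ)) ?_
  refine (hf (g ξ)).congr fun n => ?_
  exact congrArg (fun b : H →L[ℂ] H => b ξ)
    (VonNeumannAlgebra.mem_commutant_iff.1 hg (a n : H →L[ℂ] H) (a n).2)

end Projections

/-! ### Stationary states, potentials and the ergodic projection -/

section Ergodic

variable {H : Type u} [NormedAddCommGroup H] [InnerProductSpace ℂ H] [CompleteSpace H]
  {A : VonNeumannAlgebra H}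

local notation "⟪" x ", " y "⟫" => inner ℂ x y

/-- If `⟨ξ, a ξ⟩` sums to zero over the vectors `ξ` representing a normal state and `a` is
positive, then `a` vanishes on these vectors. -/
theorem apply_eq_zero_of_hasSum {ι : Type*} {η : ι → H} {a : Elem A} (ha : 0 ≤ a)
    (h : HasSum (fun i => ⟪η i, (a : H →L[ℂ] H) (η i)⟫) 0) (i : ι) :
    (a : H →L[ℂ] H) (η i) = 0 := by
  have h1 := congrFun ((hasSum_zero_iff_of_nonneg fun i => nonneg_iff_inner.1 ha (η i)).1 h) i
  have h2 := norm_apply_sq_le ha (η i)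
  rw [show ⟪η i, (a : H →L[ℂ] H) (η i)⟫ = 0 from h1, Complex.zero_re, mul_zero] at h2
  simpa using le_antisymm h2 (sq_nonneg _)

/-- The support of a normal state is dominated by the kernel projection of every positive element
on which the state vanishes. -/
theorem stateSupp_le_of_map_eq_zero {φ : Elem A →ₗ[ℂ] ℂ} (hφ : IsNormalState φ) {a : Elem A}
    (ha : 0 ≤ a) (h0 : φ a = 0) {k : Proj A}
    (hk : ∀ ξ : H, (a : H →L[ℂ] H) ξ = 0 → (k.1 : H →L[ℂ] H) ξ = ξ) : stateSupp φ ≤ k := by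
  obtain ⟨ι, η, -, hsum⟩ := hφ.exists_vectors
  refine sInf_le fun x => (hsum x).unique ((hsum _).congr_fun' fun i => ?_)
  have h1 : (k.1 : H →L[ℂ] H) (η i) = η i :=
    hk _ (apply_eq_zero_of_hasSum ha (h0 ▸ hsum a) i)
  have h2 : ∀ v w : H, ⟪(k.1 : H →L[ℂ] H) v, w⟫ = ⟪v, (k.1 : H →L[ℂ] H) w⟫ :=
    (isStarProjection_coe k).isSelfAdjoint.isSymmetric
  change ⟪η i, (x : H →L[ℂ] H) (η i)⟫ =
    ⟪η i, (k.1 : H →L[ℂ] H) ((x : H →L[ℂ] H) ((k.1 : H →L[ℂ] H) (η i)))⟫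
  rw [← h2, h1]

/-- A normal state vanishes on the complement of its support. -/
theorem map_compl_stateSupp {φ : Elem A →ₗ[ℂ] ℂ} (hφ : IsNormalState φ) :
    φ (stateSupp φ).compl.1 = 0 := by
  obtain ⟨ι, η, -, hsum⟩ := hφ.exists_vectors
  refine (hsum _).unique (hasSum_zero.congr_fun' fun i => ?_)
  -- Every p in the family defining the support fixes all η i, hence so does the infimum.
  have h1 : ((stateSupp φ).1 : H →L[ℂ] H) (η i) = η i := Proj.sInf_apply_eq fun p hp => by
    have h2 : φ p.compl.1 = 0 := by
      have h3 := hp 1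
      rw [mul_one, p.2.isIdempotentElem.eq] at h3
      change φ (1 - p.1) = 0
      rw [map_sub, h3, sub_self]
    have h4 := apply_eq_zero_of_hasSum p.compl.nonneg (h2 ▸ hsum _) i
    exact (sub_eq_zero.1 h4).symm
  rw [Proj.compl_apply, h1, sub_self, inner_zero_right]

variable {T : Elem A →ₗ[ℂ] Elem A}

theorem stateSupp_le_maxPositiveRecurrent {φ : Elem A →ₗ[ℂ] ℂ} (hφ : IsStationary T φ) :
    stateSupp φ ≤ maxPositiveRecurrent T :=
  le_sSup ⟨{φ}, by simpa using hφ, by simp⟩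

theorem maxPositiveRecurrent_le {k : Proj A} (h : ∀ φ, IsStationary T φ → stateSupp φ ≤ k) :
    maxPositiveRecurrent T ≤ k :=
  sSup_le fun _ ⟨_, hF, hp⟩ => hp.trans (iSup₂_le fun φ hφ => h φ (hF φ hφ))

/-- A stationary normal state vanishes off the positive recurrent part. -/
theorem IsStationary.map_compl_maxPositiveRecurrent {φ : Elem A →ₗ[ℂ] ℂ}
    (hφ : IsStationary T φ) : φ (maxPositiveRecurrent T).compl.1 = 0 := by
  refine le_antisymm ?_ (hφ.1.map_nonneg (Proj.nonneg _))
  have h := hφ.1.map_nonneg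
    (a := (stateSupp φ).compl.1 - (maxPositiveRecurrent T).compl.1)
    (sub_nonneg.2 (sub_le_sub_left (α := Elem A)
      (Subtype.coe_le_coe.2 (stateSupp_le_maxPositiveRecurrent hφ)) 1))
  rwa [map_sub, map_compl_stateSupp hφ.1, zero_sub, Left.nonneg_neg_iff] at h

/-- A positive element on which all stationary normal states vanish lives on the complement of the
positive recurrent part. -/
theorem eq_compl_mul_mul_compl {a : Elem A} (ha : 0 ≤ a) (h0 : ∀ φ, IsStationary T φ → φ a = 0) :
    a = (maxPositiveRecurrent T).compl.1 * a * (maxPositiveRecurrent T).compl.1 := by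
  obtain ⟨k, hk⟩ := exists_kernel_proj a
  have hle : maxPositiveRecurrent T ≤ k := maxPositiveRecurrent_le fun φ hφ =>
    stateSupp_le_of_map_eq_zero hφ.1 ha (h0 φ hφ) fun ξ => (hk ξ).2
  set r := maxPositiveRecurrent T
  have hr : a * r.1 = 0 := Subtype.ext <| ContinuousLinearMap.ext fun ξ => by
    have h1 : (r.1 : H →L[ℂ] H) ((r.1 : H →L[ℂ] H) ξ) = (r.1 : H →L[ℂ] H) ξ :=
      congrArg (fun b : H →L[ℂ] H => b ξ) (isStarProjection_coe r).isIdempotentElem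
    exact (hk _).1 (Proj.le_iff_fixed.1 hle _ h1)
  have hr' : r.1 * a = 0 := by
    have h1 := congrArg star hr
    rwa [star_mul, star_zero, r.2.isSelfAdjoint.star_eq, (IsSelfAdjoint.of_nonneg ha).star_eq]
      at h1
  change a = (1 - r.1) * a * (1 - r.1)
  rw [sub_mul, one_mul, hr', sub_zero, mul_sub, mul_one, hr, sub_zero]

theorem IsStationary.map_pow {φ : Elem A →ₗ[ℂ] ℂ} (hφ : IsStationary T φ) (n : ℕ) (x : Elem A) :
    φ ((T ^ n) x) = φ x := by
  induction n with
  | zero => rfl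
  | succ n ih =>
    rw [pow_succ', Module.End.mul_apply, ← ih]
    exact LinearMap.congr_fun hφ.2 _

theorem IsNormalMap.pow_nonneg (hT : IsNormalMap T) {x : Elem A} (hx : 0 ≤ x) (n : ℕ) :
    0 ≤ (T ^ n) x := by
  induction n with
  | zero => exact hx
  | succ n ih => rw [pow_succ', Module.End.mul_apply]; exact hT.map_nonneg ih

/-- Stationary normal states vanish on potentials. -/
theorem IsStationary.map_potential (hT : IsNormalMap T) {φ : Elem A →ₗ[ℂ] ℂ}
    (hφ : IsStationary T φ) {y : Elem A} (hy : IsPotential T y) : φ y = 0 := by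
  obtain ⟨-, x, hx, hsum⟩ := hy
  set s : ℕ → Elem A := fun N => ∑ n ∈ Finset.range N, (T ^ n) x with hs
  have hmono : Monotone s := monotone_nat_of_le_succ fun N => by
    simpa [hs, Finset.sum_range_succ] using hT.pow_nonneg hx N
  have hlim : ∀ ξ : H, Tendsto (fun N => (s N : H →L[ℂ] H) ξ) atTop (𝓝 ((y : H →L[ℂ] H) ξ)) :=
    fun ξ => (hsum ξ).congr fun N => by simp [hs]
  have hle : ∀ N, s N ≤ y := fun N => by
    rw [← sub_nonneg, nonneg_iff_inner]
    intro ξ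
    -- Using max M N makes the inequality valid for all M without changing the limit.
    refine ge_of_tendsto' (x := atTop)
      (f := fun M => ⟪ξ, ((s (max M N) - s N : Elem A) : H →L[ℂ] H) ξ⟫) ?_ fun M =>
        nonneg_iff_inner.1 (sub_nonneg.2 (hmono (le_max_right M N))) ξ
    refine tendsto_const_nhds.inner (Tendsto.sub_const ?_ _)
    exact (hlim ξ).comp (tendsto_atTop_mono (fun M => le_max_left M N) tendsto_id)
  have hs0 : ∀ N, 0 ≤ s N := fun N => Finset.sum_nonneg fun n _ => hT.pow_nonneg hx n
  have ht := hφ.1.tendsto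
    (fun N => CStarAlgebra.norm_le_norm_of_nonneg_of_le (hs0 N) (hle N)) hlim
  have hval : ∀ N, φ (s N) = N * φ x := fun N => by simp [hs, hφ.map_pow]
  simp only [hval] at ht
  -- The increments of the convergent sequence N φ(x) are constantly φ(x), so φ(x) = 0.
  have hstep : Tendsto (fun N : ℕ => ((N + 1 : ℕ) : ℂ) * φ x - N * φ x) atTop (𝓝 (φ y - φ y)) :=
    (ht.comp (tendsto_add_atTop_nat 1)).sub ht
  have hx0 : φ x = 0 := by
    rw [sub_self] at hstep
    refine tendsto_nhds_unique (tendsto_const_nhds.congr fun N => ?_) hstep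
    push_cast
    ring
  simp only [hx0, mul_zero] at ht
  exact tendsto_nhds_unique ht tendsto_const_nhds

/-- Potentials are killed by all stationary states, so each equals its compression by this
complement, which then dominates its support. -/
theorem maxTransient_le_compl (hT : IsNormalMap T) :
    maxTransient T ≤ (maxPositiveRecurrent T).compl := by
  refine sSup_le fun p ⟨Y, hY, hp⟩ => hp.trans (iSup₂_le fun y hy => sInf_le ?_)
  exact eq_compl_mul_mul_compl (hY y hy).1 fun φ hφ => hφ.map_potential hT (hY y hy)

/-- An ergodic projection fixes the fixed points of `T`. -/
theorem IsErgodicProjection.apply_eq_of_fixed {P : Elem A →ₗ[ℂ] Elem A}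
    (hP : IsErgodicProjection T P) {z : Elem A} (hz : T z = z) : P z = z := by
  refine eq_of_normalState fun φ hφ => ?_
  have hpow : ∀ n : ℕ, (T ^ n) z = z := fun n => by
    induction n with
    | zero => rfl
    | succ n ih => rw [pow_succ, Module.End.mul_apply, hz, ih]
  have hconv : convexHull ℝ {Φ | ∃ n : ℕ, 1 ≤ n ∧ Φ = T ^ n} ⊆ {Φ | Φ z = z} := by
    refine convexHull_min ?_ ?_
    · rintro _ ⟨n, -, rfl⟩
      exact hpow n
    · intro Φ hΦ Ψ hΨ a b _ _ hab
      change a • Φ z + b • Ψ z = z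
      rw [show Φ z = z from hΦ, show Ψ z = z from hΨ, ← add_smul, hab, one_smul]
  let := weakStarTopology A
  have hcont : Continuous fun f : Elem A → Elem A => φ (f z) := by
    have h1 : @Continuous _ _ (weakStarTopology A) _ φ :=
      continuous_iInf_dom (i := φ) (continuous_iInf_dom (i := hφ) continuous_induced_dom)
    exact h1.comp (continuous_apply z)
  -- The condition φ (f z) = φ z is closed in the pointwise weak* topology and holds on the convex
  -- hull of the powers.
  refine closure_minimal (t := {f : Elem A → Elem A | φ (f z) = φ z}) ?_
    (isClosed_eq hcont continuous_const) hP.mem_closure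
  rintro _ ⟨Φ, hΦ, rfl⟩
  exact congrArg φ (hconv hΦ)

/-- A normal ergodic projection vanishes off the positive recurrent part. -/
theorem IsErgodicProjection.map_compl_maxPositiveRecurrent {P : Elem A →ₗ[ℂ] Elem A}
    (hP : IsErgodicProjection T P) (hPn : IsNormalMap P) :
    P (maxPositiveRecurrent T).compl.1 = 0 := by
  refine eq_of_normalState fun φ hφ => ?_
  have h : IsStationary T (φ ∘ₗ P) :=
    ⟨hPn φ hφ, by rw [LinearMap.comp_assoc, hP.comp_right]⟩
  rw [map_zero]
  exact h.map_compl_maxPositiveRecurrent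

/-- The complement of the positive recurrent part is superharmonic. -/
theorem map_compl_maxPositiveRecurrent_le (hT : IsNormalMap T) :
    T (maxPositiveRecurrent T).compl.1 ≤ (maxPositiveRecurrent T).compl.1 := by
  set q := (maxPositiveRecurrent T).compl with hq
  have h0 : 0 ≤ T q.1 := hT.map_nonneg q.nonneg
  have h1 : T q.1 ≤ 1 := by
    rw [← hT.map_one]
    exact hT.mono q.le_one
  have h2 : T q.1 = q.1 * T q.1 * q.1 := eq_compl_mul_mul_compl h0 fun φ hφ =>
    (LinearMap.congr_fun hφ.2 q.1).trans hφ.map_compl_maxPositiveRecurrent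
  have h3 := star_left_conjugate_le_conjugate h1 q.1
  rwa [q.2.isSelfAdjoint.star_eq, ← h2, mul_one, q.2.isIdempotentElem.eq] at h3

/-- If `T` is weak* mean ergodic, the complement of the positive recurrent part is a potential. -/
theorem isPotential_compl_maxPositiveRecurrent (hT : IsNormalMap T)
    (herg : IsWeakStarMeanErgodic T) : IsPotential T (maxPositiveRecurrent T).compl.1 := by
  obtain ⟨P, hP, hPn⟩ := herg
  have hPq := hP.map_compl_maxPositiveRecurrent hPn
  have hTq := map_compl_maxPositiveRecurrent_le hT
  set q := (maxPositiveRecurrent T).compl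
  set a : ℕ → Elem A := fun n => (T ^ n) q.1 with ha
  have hsucc : ∀ n, a (n + 1) = T (a n) := fun n => by
    simp only [ha, pow_succ', Module.End.mul_apply]
  have h0 : ∀ n, 0 ≤ a n := hT.pow_nonneg q.nonneg
  have hanti : Antitone a := antitone_nat_of_succ_le fun n => by
    have h := hT.pow_nonneg (sub_nonneg.2 hTq) n
    rw [map_sub, sub_nonneg] at h
    simpa only [ha, pow_succ, Module.End.mul_apply] using h
  obtain ⟨z, hz⟩ := exists_tendsto_of_antitone hanti h0
  have hz0 : 0 ≤ z := nonneg_iff_inner.2 fun ξ =>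
    ge_of_tendsto' (tendsto_const_nhds.inner (hz ξ)) fun n => nonneg_iff_inner.1 (h0 n) ξ
  have hzq : z ≤ q.1 := by
    rw [← sub_nonneg, nonneg_iff_inner]
    intro ξ
    exact ge_of_tendsto' (tendsto_const_nhds.inner ((hz ξ).const_sub ((q.1 : H →L[ℂ] H) ξ)))
      fun n => nonneg_iff_inner.1 (sub_nonneg.2 (hanti (Nat.zero_le n))) ξ
  have hbound : ∀ n, ‖a n‖ ≤ ‖a 0‖ := fun n =>
    CStarAlgebra.norm_le_norm_of_nonneg_of_le (h0 n) (hanti (Nat.zero_le n))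
  -- Both φ and φ ∘ T are normal, so φ (T (a n)) tends to φ (T z) and, being φ (a (n + 1)), also to
  -- φ z.
  have hfix : T z = z := eq_of_normalState fun φ hφ => by
    have h1 := (hT φ hφ).tendsto hbound hz
    have h2 := (hφ.tendsto hbound hz).comp (tendsto_add_atTop_nat 1)
    refine tendsto_nhds_unique h1 (h2.congr fun n => ?_)
    rw [Function.comp_apply, hsucc]
    rfl
  have hzero : z = 0 := le_antisymm (by
    rw [← hP.apply_eq_of_fixed hfix, ← hPq]
    exact hPn.mono hzq) hz0
  -- With charge q - T q the N-th partial sum is q - T^N q, and T^N q tends strongly to z = 0.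
  refine ⟨q.nonneg, q.1 - T q.1, sub_nonneg.2 hTq, fun ξ => ?_⟩
  have hsum : ∀ N, ∑ n ∈ Finset.range N, (((T ^ n) (q.1 - T q.1) : Elem A) : H →L[ℂ] H) ξ =
      (q.1 : H →L[ℂ] H) ξ - (a N : H →L[ℂ] H) ξ := fun N => by
    rw [show (q.1 : H →L[ℂ] H) ξ = (a 0 : H →L[ℂ] H) ξ from rfl,
      ← Finset.sum_range_sub' (fun n => (a n : H →L[ℂ] H) ξ)]
    refine Finset.sum_congr rfl fun n _ => ?_
    rw [map_sub, ← Module.End.mul_apply, ← pow_succ]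
    rfl
  simp only [hsum]
  have h1 := (hz ξ).const_sub ((q.1 : H →L[ℂ] H) ξ)
  rw [hzero] at h1
  simpa using h1

/-- The projection q is below its own support: q = p q p ≤ p for every competing p. So q, being a
potential, is transient. -/
theorem maxTransient_eq_compl (hT : IsNormalMap T) (herg : IsWeakStarMeanErgodic T) :
    maxTransient T = (maxPositiveRecurrent T).compl := by
  refine le_antisymm (maxTransient_le_compl hT) ?_
  have hpot := isPotential_compl_maxPositiveRecurrent hT herg
  set q := (maxPositiveRecurrent T).compl
  have hsupp : q ≤ supp q.1 := le_sInf fun p hp => by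
    have h1 := star_left_conjugate_le_conjugate q.le_one p.1
    rw [p.2.isSelfAdjoint.star_eq, mul_one, p.2.isIdempotentElem.eq] at h1
    exact (show q.1 = p.1 * q.1 * p.1 from hp).le.trans h1
  exact le_sSup ⟨{q.1}, by simpa using hpot, by simpa using hsupp⟩

end Ergodic
end QMarkov

theorem mainTheorem10 {H : Type u} [NormedAddCommGroup H] [InnerProductSpace ℂ H]
    [CompleteSpace H] (A : VonNeumannAlgebra H)
    (T : QMarkov.Elem A →ₗ[ℂ] QMarkov.Elem A) (hT : QMarkov.IsMarkov T)
    (herg : QMarkov.IsWeakStarMeanErgodic T) :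
    QMarkov.maxNullRecurrent T = 0 ∧
      (QMarkov.maxTransient T).1 + (QMarkov.maxPositiveRecurrent T).1 = 1 ∧
      QMarkov.IsPotential T (QMarkov.maxTransient T).1 := by
  have h := QMarkov.maxTransient_eq_compl hT.normal herg
  have h1 : (QMarkov.maxTransient T).1 + (QMarkov.maxPositiveRecurrent T).1 = 1 := by
    rw [h]
    exact sub_add_cancel _ _
  refine ⟨sub_eq_zero.2 h1.symm, h1, ?_⟩
  rw [h]
  exact QMarkov.isPotential_compl_maxPositiveRecurrent hT.normal herg
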